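/- Let $(\breve N,\breve g)$ be a semi-Riemannian manifold with Levi-Civita connection $\breve\nabla$, and let $\breve P$ be a locally Golden structure on it, i.e. a smooth $(1,1)$-tensor field with $\breve P^2=\breve P+I$, $\breve g(\breve PX,Y)=\breve g(X,\breve PY)$ and $\breve\nabla\breve P=0$. Let $\acute N$ be a lightlike submanifold of $\breve N$: an immersed submanifold, with induced metric $g$, whose radical distribution $\mathrm{Rad}\,T\acute N=T\acute N\cap T\acute N^{\perp}$ has constant rank $r\ge 1$, together with smooth vector bundles $S(T\acute N)$, $S(T\acute N^{\perp})$ and $\mathrm{ltr}(T\acute N)$ over $\acute N$ such that $T\acute N=\mathrm{Rad}\,T\acute N\perp S(T\acute N)$, $T\acute N^{\perp}=\mathrm{Rad}\,T\acute N\perp S(T\acute N^{\perp})$ and $$T\breve N|_{\acute N}=S(T\acute N)\perp[\mathrm{Rad}\,T\acute N\oplus \mathrm{ltr}(T\acute N)]\perp S(T\acute N^{\perp}),$$ where $\perp$ denotes an orthogonal direct sum. (The bundle $\mathrm{ltr}(T\acute N)$ may, but need not, be totally null.) Put $\mathrm{tr}(T\acute N)=\mathrm{ltr}(T\acute N)\perp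 S(T\acute N^{\perp})$, so that $T\breve N|_{\acute N}=T\acute N\oplus \mathrm{tr}(T\acute N)$. For $W,U\in\Gamma(T\acute N)$ and $V\in\Gamma(\mathrm{tr}(T\acute N))$ let $\nabla_WU$ and $-A_VW$ be the $T\acute N$-components of $\breve\nabla_WU$ and of $\breve\nabla_WV$, respectively, in this decomposition; $\nabla$ is the induced connection on $\acute N$. Assume that $\acute N$ is radical transversal, i.e. $\breve P(\mathrm{Rad}\,T\acute N)=\mathrm{ltr}(T\acute N)$ and $\breve P(S(T\acute N))=S(T\acute N)$. Then the induced connection is a metric connection, i.e. $W\,g(U,V)=g(\nabla_WU,V)+g(U,\nabla_WV)$ for all $W,U,V\in\Gamma(T\acute N)$, if and only if $$A_{\breve P\xi}W\in\Gamma(\mathrm{Rad}\,T\acute N)\quad\text{for all } W\in\Gamma(T\acute N),\ \xi\in\Gamma(\mathrm{Rad}\,T\acute N).$$ -/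

import Mathlib

open Bundle Set Manifold
open scoped Manifold ContDiff Topology

noncomputable section

/-! ### Semi-Riemannian and Golden geometry of the ambient manifold -/

section Ambient

variable (E : Type*) [NormedAddCommGroup E] [NormedSpace ℝ E]
  (M : Type*) [TopologicalSpace M] [ChartedSpace E M] [IsManifold 𝓘(ℝ, E) ∞ M]

/-- A smooth semi-Riemannian metric on the manifold `M`: a smooth symmetric nondegenerate
`(0,2)`-tensor field. -/
structure SemiRiemannianMetric where
  val (y : M) : TangentSpace 𝓘(ℝ, E) y →L[ℝ] TangentSpace 𝓘(ℝ, E) y →L[ℝ] ℝ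
  symm (y : M) (u v : TangentSpace 𝓘(ℝ, E) y) : val y u v = val y v u
  nondegenerate (y : M) (u : TangentSpace 𝓘(ℝ, E) y) : (∀ v, val y u v = 0) → u = 0
  contMDiff : ContMDiff 𝓘(ℝ, E) (𝓘(ℝ, E).prod 𝓘(ℝ, E →L[ℝ] E →L[ℝ] ℝ)) ∞
    (fun y ↦ TotalSpace.mk' (E →L[ℝ] E →L[ℝ] ℝ) y (val y))

variable {E M}

/-- The connection `cov` on the tangent bundle is the Levi-Civita connection of `g`: it is
torsion-free and `X g(Y, Z) = g(∇_X Y, Z) + g(Y, ∇_X Z)`. In Mathlib's convention,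
`cov Y y w` is `∇_w Y` at the point `y`. -/
structure SemiRiemannianMetric.IsLeviCivita (g : SemiRiemannianMetric E M)
    (cov : CovariantDerivative 𝓘(ℝ, E) E (TangentSpace 𝓘(ℝ, E) : M → Type _)) : Prop where
  torsion_free : ∀ (X Y : ∀ y : M, TangentSpace 𝓘(ℝ, E) y) (y : M),
    MDiffAt (T% X) y → MDiffAt (T% Y) y →
      cov Y y (X y) - cov X y (Y y) = VectorField.mlieBracket 𝓘(ℝ, E) X Y y
  metric : ∀ (Y Z : ∀ y : M, TangentSpace 𝓘(ℝ, E) y) (y : M),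
    MDiffAt (T% Y) y → MDiffAt (T% Z) y → ∀ w : TangentSpace 𝓘(ℝ, E) y,
      mvfderiv 𝓘(ℝ, E) (fun z ↦ g.val z (Y z) (Z z)) y w =
        g.val y (cov Y y w) (Z y) + g.val y (Y y) (cov Z y w)

/-- A Golden structure `P` on the semi-Riemannian manifold `(M, g)`: a smooth `(1,1)`-tensor field
with `P² = P + I` and `g(PU, V) = g(U, PV)`. -/
structure GoldenStructure (g : SemiRiemannianMetric E M) where
  toFun (y : M) : TangentSpace 𝓘(ℝ, E) y →L[ℝ] TangentSpace 𝓘(ℝ, E) y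
  contMDiff : ContMDiff 𝓘(ℝ, E) (𝓘(ℝ, E).prod 𝓘(ℝ, E →L[ℝ] E)) ∞
    (fun y ↦ TotalSpace.mk' (E →L[ℝ] E) y (toFun y))
  golden (y : M) (u : TangentSpace 𝓘(ℝ, E) y) : toFun y (toFun y u) = toFun y u + u
  compatible (y : M) (u v : TangentSpace 𝓘(ℝ, E) y) :
    g.val y (toFun y u) v = g.val y u (toFun y v)

/-- The Golden structure is parallel with respect to the connection `cov`:
`∇_w (P U) = P (∇_w U)`. When `cov` is the Levi-Civita connection, this is the condition for
`(M, g, P)` to be locally Golden. -/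
def GoldenStructure.IsParallel {g : SemiRiemannianMetric E M} (P : GoldenStructure g)
    (cov : CovariantDerivative 𝓘(ℝ, E) E (TangentSpace 𝓘(ℝ, E) : M → Type _)) : Prop :=
  ∀ (U : ∀ y : M, TangentSpace 𝓘(ℝ, E) y) (y : M), MDiffAt (T% U) y →
    ∀ w : TangentSpace 𝓘(ℝ, E) y,
      cov (fun z ↦ P.toFun z (U z)) y w = P.toFun y (cov U y w)

end Ambient

/-! ### Vector fields along a map -/

section Along

set_option linter.unusedSectionVars false

variable {E : Type*} [NormedAddCommGroup E] [NormedSpace ℝ E]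
  {M : Type*} [TopologicalSpace M] [ChartedSpace E M] [IsManifold 𝓘(ℝ, E) ∞ M]
  {F : Type*} [NormedAddCommGroup F] [NormedSpace ℝ F]
  {N : Type*} [TopologicalSpace N] [ChartedSpace F N] [IsManifold 𝓘(ℝ, F) ∞ N]

/-- The vector field `V` along `i : N → M` (a section of `i^* TM`) is smooth on the set `s`. For
`i = id`, these are the vector fields on `N`. -/
def SmoothAlongOn (i : N → M) (V : ∀ x : N, TangentSpace 𝓘(ℝ, E) (i x)) (s : Set N) : Prop :=
  ContMDiffOn 𝓘(ℝ, F) 𝓘(ℝ, E).tangent ∞ (fun x ↦ (⟨i x, V x⟩ : TangentBundle 𝓘(ℝ, E) M)) s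

/-- `V` is a smooth vector field on `N`. -/
def IsSmoothVectorField (V : ∀ x : N, TangentSpace 𝓘(ℝ, F) x) : Prop :=
  ContMDiff 𝓘(ℝ, F) 𝓘(ℝ, F).tangent ∞ (fun x ↦ (⟨x, V x⟩ : TangentBundle 𝓘(ℝ, F) N))

/-- The family `D` of subspaces of the tangent spaces of `M` along `i` is a smooth subbundle of
`i^* TM`: near each point it has a smooth local frame. -/
def IsSmoothSubbundleAlong (i : N → M)
    (D : ∀ x : N, Submodule ℝ (TangentSpace 𝓘(ℝ, E) (i x))) : Prop :=
  ∀ x₀ : N, ∃ (k : ℕ) (s : Fin k → ∀ x : N, TangentSpace 𝓘(ℝ, E) (i x)) (O : Set N),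
    IsOpen O ∧ x₀ ∈ O ∧ (∀ a, SmoothAlongOn (F := F) i (s a) O) ∧
    ∀ x ∈ O, LinearIndependent ℝ (fun a ↦ s a x) ∧
      Submodule.span ℝ (Set.range fun a ↦ s a x) = D x

/-- The derivative `∇_w V` of a vector field `V` along `i : N → M` in the direction `w ∈ T_x N`,
i.e. the pull-back to `i^* TM` of the connection `cov`. In the local frame `(e_a)` of `TM` given by
the preferred trivialization at `i x`, write `V = ∑ V^a (e_a ∘ i)`. Then
`∇_w V = ∑ (dV^a) (w) e_a + ∑ V^a(x) ∇_{di (w)} e_a`. The field `FiberBundle.extend E (V x)` is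
`∑ V^a(x) e_a`, with the coefficients frozen at `x`. -/
def covAlong (cov : CovariantDerivative 𝓘(ℝ, E) E (TangentSpace 𝓘(ℝ, E) : M → Type _))
    (i : N → M) (V : ∀ x : N, TangentSpace 𝓘(ℝ, E) (i x)) (x : N)
    (w : TangentSpace 𝓘(ℝ, F) x) : TangentSpace 𝓘(ℝ, E) (i x) :=
  (trivializationAt E (TangentSpace 𝓘(ℝ, E) : M → Type _) (i x)).symm (i x)
      (mvfderiv 𝓘(ℝ, F) (fun z ↦
        (trivializationAt E (TangentSpace 𝓘(ℝ, E) : M → Type _) (i x) ⟨i z, V z⟩).2) x w)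
    + cov (FiberBundle.extend E (V x)) (i x) (mfderiv 𝓘(ℝ, F) 𝓘(ℝ, E) i x w)

/-- The image `di (T_x N)` of the tangent space of `N`. -/
def tangentImage (i : N → M) (x : N) : Submodule ℝ (TangentSpace 𝓘(ℝ, E) (i x)) :=
  LinearMap.range (mfderiv 𝓘(ℝ, F) 𝓘(ℝ, E) i x).toLinearMap

/-- The orthogonal space `T_x N^⊥` in the tangent space of `M`. -/
def normalSpace (g : SemiRiemannianMetric E M) (i : N → M) (x : N) :
    Submodule ℝ (TangentSpace 𝓘(ℝ, E) (i x)) where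
  carrier := {u | ∀ v : TangentSpace 𝓘(ℝ, F) x,
    g.val (i x) u (mfderiv 𝓘(ℝ, F) 𝓘(ℝ, E) i x v) = 0}
  zero_mem' := by intro v; simp
  add_mem' := by intro a b ha hb v; simp [ha v, hb v]
  smul_mem' := by intro c a ha v; simp [ha v]

/-- The radical `Rad T_x N = T_x N ∩ T_x N^⊥`, as a subspace of `T_x N`. -/
def radical (g : SemiRiemannianMetric E M) (i : N → M) (x : N) :
    Submodule ℝ (TangentSpace 𝓘(ℝ, F) x) :=
  (normalSpace (F := F) g i x).comap (mfderiv 𝓘(ℝ, F) 𝓘(ℝ, E) i x).toLinearMap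

/-- The degenerate metric induced on `N`. -/
def inducedMetric (g : SemiRiemannianMetric E M) (i : N → M) (x : N)
    (u v : TangentSpace 𝓘(ℝ, F) x) : ℝ :=
  g.val (i x) (mfderiv 𝓘(ℝ, F) 𝓘(ℝ, E) i x u) (mfderiv 𝓘(ℝ, F) 𝓘(ℝ, E) i x v)

/-- The differential of an immersion is injective. -/
theorem immersion_mfderiv_injective {i : N → M}
    (hi : IsImmersion 𝓘(ℝ, F) 𝓘(ℝ, E) ∞ i) (x : N) :
    Function.Injective (mfderiv 𝓘(ℝ, F) 𝓘(ℝ, E) i x) := by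
  have hx := (hi.isImmersionAt x).isImmersionAtOfComplement_complement
  set φ := hx.domChart with hφ
  set ψ := hx.codChart with hψ
  set p : E → F := fun e ↦ (hx.equiv.symm e).1 with hp
  have hne : (∞ : WithTop ℕ∞) ≠ 0 := by simp
  have hxφ : x ∈ φ.source := hx.mem_domChart_source
  have hxψ : i x ∈ ψ.source := hx.mem_codChart_source
  have hwr : ∀ y ∈ φ.source, ψ (i y) = hx.equiv (φ y, 0) := by
    intro y hy
    have hmem : φ y ∈ (φ.extend 𝓘(ℝ, F)).target := by simpa using φ.map_source hy
    have := hx.writtenInCharts hmem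
    simpa [← hφ, ← hψ, φ.left_inv hy] using this
  have hpx : p (ψ (i x)) = φ x := by simp [hp, hwr x hxφ]
  have h1 : MDifferentiableAt 𝓘(ℝ, E) 𝓘(ℝ, E) ψ (i x) :=
    (contMDiffAt_of_mem_maximalAtlas hx.codChart_mem_maximalAtlas hxψ).mdifferentiableAt hne
  have h2 : MDifferentiableAt 𝓘(ℝ, E) 𝓘(ℝ, F) p (ψ (i x)) := by
    refine DifferentiableAt.mdifferentiableAt ?_
    exact differentiableAt_fst.comp _ hx.equiv.symm.differentiableAt
  have h3 : MDifferentiableAt 𝓘(ℝ, F) 𝓘(ℝ, F) φ.symm (p (ψ (i x))) := by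
    rw [hpx]
    exact (contMDiffAt_symm_of_mem_maximalAtlas hx.domChart_mem_maximalAtlas
      (φ.map_source hxφ)).mdifferentiableAt hne
  have h4 : MDifferentiableAt 𝓘(ℝ, F) 𝓘(ℝ, E) i x := hx.contMDiffAt.mdifferentiableAt hne
  have h5 : MDifferentiableAt 𝓘(ℝ, E) 𝓘(ℝ, F) (φ.symm ∘ p ∘ ψ) (i x) :=
    MDifferentiableAt.comp (i x) (f := p ∘ ψ) h3 (MDifferentiableAt.comp (i x) h2 h1)
  have h6 : (φ.symm ∘ p ∘ ψ) ∘ i =ᶠ[𝓝 x] id := by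
    filter_upwards [φ.open_source.mem_nhds hxφ] with y hy
    simp [hp, hwr y hy, φ.left_inv hy]
  have h7 := mfderiv_comp x h5 h4
  rw [h6.mfderiv_eq, mfderiv_id] at h7
  intro u v huv
  have hu := congrArg (fun T ↦ T u) h7
  have hv := congrArg (fun T ↦ T v) h7
  simp only [ContinuousLinearMap.comp_apply] at hu hv
  rw [huv] at hu
  exact hu.trans hv.symm

end Along

/-! ### Lightlike submanifolds -/

section Lightlike

variable {E : Type*} [NormedAddCommGroup E] [NormedSpace ℝ E]
  {M : Type*} [TopologicalSpace M] [ChartedSpace E M] [IsManifold 𝓘(ℝ, E) ∞ M]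
  {F : Type*} [NormedAddCommGroup F] [NormedSpace ℝ F]
  {N : Type*} [TopologicalSpace N] [ChartedSpace F N] [IsManifold 𝓘(ℝ, F) ∞ N]

/-- The structure of a lightlike submanifold `(N, g, S(TN), S(TN^⊥), ltr(TN))` of `(M, g)` on
`i : N → M`: an immersion whose radical distribution has constant rank `r ≥ 1`, with a screen
distribution `S(TN)`, a screen transversal bundle `S(TN^⊥)` and a transversal bundle `ltr(TN)` such
that `TM|_N = S(TN) ⊥ [Rad TN ⊕ ltr(TN)] ⊥ S(TN^⊥)`.

Nondegeneracy of `S(TN)` and `S(TN^⊥)` and of the pairing of `Rad TN` with `ltr(TN)` follows from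
the fields. That `ltr(TN)` be moreover totally null is not demanded: the structure comprises both
the null and the non-null choices of `ltr(TN)`. -/
structure LightlikeSubmanifold (g : SemiRiemannianMetric E M) (i : N → M) where
  immersion : IsImmersion 𝓘(ℝ, F) 𝓘(ℝ, E) ∞ i
  /-- the rank of the radical distribution -/
  r : ℕ
  one_le_r : 1 ≤ r
  finrank_radical : ∀ x, Module.finrank ℝ (radical (F := F) g i x) = r
  /-- the screen distribution `S(TN)` -/
  screen : ∀ x : N, Submodule ℝ (TangentSpace 𝓘(ℝ, F) x)
  screen_smooth : IsSmoothSubbundleAlong (F := F) (fun x : N ↦ x) screen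
  isCompl_screen : ∀ x, IsCompl (radical g i x) (screen x)
  /-- the screen transversal bundle `S(TN^⊥)` -/
  screenTrans : ∀ x : N, Submodule ℝ (TangentSpace 𝓘(ℝ, E) (i x))
  screenTrans_smooth : IsSmoothSubbundleAlong (F := F) i screenTrans
  screenTrans_disjoint : ∀ x, Disjoint
    ((radical g i x).map (mfderiv 𝓘(ℝ, F) 𝓘(ℝ, E) i x).toLinearMap) (screenTrans x)
  screenTrans_sup : ∀ x,
    (radical g i x).map (mfderiv 𝓘(ℝ, F) 𝓘(ℝ, E) i x).toLinearMap ⊔ screenTrans x =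
      normalSpace (F := F) g i x
  /-- the transversal bundle `ltr(TN)` -/
  ltr : ∀ x : N, Submodule ℝ (TangentSpace 𝓘(ℝ, E) (i x))
  ltr_smooth : IsSmoothSubbundleAlong (F := F) i ltr
  ltr_orthogonal_screen : ∀ x, ∀ n ∈ ltr x, ∀ u ∈ screen x,
    g.val (i x) n (mfderiv 𝓘(ℝ, F) 𝓘(ℝ, E) i x u) = 0
  ltr_orthogonal_screenTrans : ∀ x, ∀ n ∈ ltr x, ∀ z ∈ screenTrans x, g.val (i x) n z = 0
  ltr_disjoint : ∀ x, Disjoint (ltr x) (screenTrans x)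
  /-- `TM|_N = TN ⊕ tr(TN)`, where `tr(TN) = ltr(TN) ⊥ S(TN^⊥)` -/
  isCompl_tr : ∀ x, IsCompl (tangentImage (F := F) i x) (ltr x ⊔ screenTrans x)

namespace LightlikeSubmanifold

variable {g : SemiRiemannianMetric E M} {i : N → M}

/-- The projection of `T_{i x} M = T_x N ⊕ tr(TN)_x` to `T_x N`. -/
def tangentPart (L : LightlikeSubmanifold (F := F) g i) (x : N) :
    TangentSpace 𝓘(ℝ, E) (i x) →ₗ[ℝ] TangentSpace 𝓘(ℝ, F) x :=
  (LinearEquiv.ofInjective (mfderiv 𝓘(ℝ, F) 𝓘(ℝ, E) i x).toLinearMap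
      (immersion_mfderiv_injective L.immersion x)).symm.toLinearMap ∘ₗ
    Submodule.projectionOnto (tangentImage (F := F) i x) (L.ltr x ⊔ L.screenTrans x)
      (L.isCompl_tr x)

/-- The induced connection `∇` on `N`: `∇_w U` is the `TN`-component in the Gauss equation
`∇̃_w U = ∇_w U + h(w, U)`. -/
def inducedConnection (L : LightlikeSubmanifold (F := F) g i)
    (cov : CovariantDerivative 𝓘(ℝ, E) E (TangentSpace 𝓘(ℝ, E) : M → Type _))
    (U : ∀ x : N, TangentSpace 𝓘(ℝ, F) x) (x : N) (w : TangentSpace 𝓘(ℝ, F) x) :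
    TangentSpace 𝓘(ℝ, F) x :=
  L.tangentPart x (covAlong cov i (fun z ↦ mfderiv 𝓘(ℝ, F) 𝓘(ℝ, E) i z (U z)) x w)

/-- The shape operator `A_V` of a section `V` of `tr(TN)`: `-A_V w` is the `TN`-component in the
Weingarten equation `∇̃_w V = -A_V w + ∇^t_w V`. -/
def shapeOperator (L : LightlikeSubmanifold (F := F) g i)
    (cov : CovariantDerivative 𝓘(ℝ, E) E (TangentSpace 𝓘(ℝ, E) : M → Type _))
    (V : ∀ x : N, TangentSpace 𝓘(ℝ, E) (i x)) (x : N) (w : TangentSpace 𝓘(ℝ, F) x) :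
    TangentSpace 𝓘(ℝ, F) x :=
  -L.tangentPart x (covAlong cov i V x w)

/-- The induced connection is a metric connection: `W g(U, V) = g(∇_W U, V) + g(U, ∇_W V)` for all
smooth vector fields `W`, `U`, `V` on `N`. -/
def InducedConnectionIsMetric (L : LightlikeSubmanifold (F := F) g i)
    (cov : CovariantDerivative 𝓘(ℝ, E) E (TangentSpace 𝓘(ℝ, E) : M → Type _)) : Prop :=
  ∀ W U V : (∀ x : N, TangentSpace 𝓘(ℝ, F) x),
    IsSmoothVectorField W → IsSmoothVectorField U → IsSmoothVectorField V → ∀ x : N,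
      mvfderiv 𝓘(ℝ, F) (fun z ↦ inducedMetric g i z (U z) (V z)) x (W x) =
        inducedMetric g i x (L.inducedConnection cov U x (W x)) (V x) +
          inducedMetric g i x (U x) (L.inducedConnection cov V x (W x))

/-- The lightlike submanifold is radical transversal: `P (Rad TN) = ltr(TN)` and
`P (S(TN)) = S(TN)`. -/
structure IsRadicalTransversal (L : LightlikeSubmanifold (F := F) g i)
    (P : GoldenStructure g) : Prop where
  map_radical : ∀ x, ((radical g i x).map (mfderiv 𝓘(ℝ, F) 𝓘(ℝ, E) i x).toLinearMap).map
    (P.toFun (i x)).toLinearMap = L.ltr x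
  map_screen : ∀ x, ((L.screen x).map (mfderiv 𝓘(ℝ, F) 𝓘(ℝ, E) i x).toLinearMap).map
    (P.toFun (i x)).toLinearMap = (L.screen x).map (mfderiv 𝓘(ℝ, F) 𝓘(ℝ, E) i x).toLinearMap

end LightlikeSubmanifold

end Lightlike

end

noncomputable section

/-! ### Calculus of vector-valued functions on a manifold -/

section VectorValued

variable {F : Type*} [NormedAddCommGroup F] [NormedSpace ℝ F]
  {N : Type*} [TopologicalSpace N] [ChartedSpace F N]
  {E : Type*} [NormedAddCommGroup E] [NormedSpace ℝ E]
  {E' : Type*} [NormedAddCommGroup E'] [NormedSpace ℝ E']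

/-! Write D for the ambient connection pulled back along `i`. Both conditions are equivalent to a
third, `RadicalDerivOrthogonalScreen`: g(D_W ξ, u) = 0 for every section ξ of Rad TN and every u in
the screen.

Shape operator: D commutes with P, so A_{Pξ} W is minus the tangential part of P(D_W ξ). It is
radical iff it is orthogonal to the screen. Since tr(TN) is orthogonal to the screen, this says g(P
D_W ξ, u) = g(D_W ξ, Pu) = 0, and P maps the screen onto itself.

Metric connection: testing metricity on g(ξ, U) = 0 gives the third condition. Conversely, let ρ and
σ be the radical parts of U and V at x. As D is metric, the defect of metricity of ∇ at x is g(D_W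
U, σ) + g(D_W V, ρ). Extend ρ and σ to radical sections η and ξ. Differentiating g(ξ, U) = 0 and
g(η, V) = 0, and using the third condition, turns the defect into -(g(D_W ξ, ρ) + g(D_W η, σ)) = -W
g(η, ξ) = 0. Nullity of ltr(TN) plays no role.

Two supports are needed: D is metric and commutes with P (`mvfderiv_along`,
`GoldenStructure.IsParallel.covAlong`), and radical vectors extend to smooth radical sections
(`exists_smooth_radical`). -/

theorem mvfderiv_clm_apply {G : N → E →L[ℝ] E'} {A : N → E} {x : N}
    (hG : MDifferentiableAt 𝓘(ℝ, F) 𝓘(ℝ, E →L[ℝ] E') G x)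
    (hA : MDifferentiableAt 𝓘(ℝ, F) 𝓘(ℝ, E) A x) (w : TangentSpace 𝓘(ℝ, F) x) :
    mvfderiv 𝓘(ℝ, F) (fun z ↦ G z (A z)) x w =
      mvfderiv 𝓘(ℝ, F) G x w (A x) + G x (mvfderiv 𝓘(ℝ, F) A x w) := by
  rw [(hG.clm_apply hA).mvfderiv, hG.mvfderiv, hA.mvfderiv]
  have h1 := hG.differentiableWithinAt_writtenInExtChartAt
  have h2 := hA.differentiableWithinAt_writtenInExtChartAt
  have hu : UniqueDiffWithinAt ℝ (range 𝓘(ℝ, F)) (extChartAt 𝓘(ℝ, F) x x) := by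
    simp
  have h3 := fderivWithin_clm_apply hu h1 h2
  have hGx : writtenInExtChartAt 𝓘(ℝ, F) 𝓘(ℝ, E →L[ℝ] E') x G (extChartAt 𝓘(ℝ, F) x x) = G x :=
    congrArg G (extChartAt_to_inv x)
  have hAx : writtenInExtChartAt 𝓘(ℝ, F) 𝓘(ℝ, E) x A (extChartAt 𝓘(ℝ, F) x x) = A x :=
    congrArg A (extChartAt_to_inv x)
  rw [hGx, hAx] at h3
  exact (congrArg (fun T : F →L[ℝ] E' ↦ T w) h3).trans (add_comm _ _)

theorem Filter.EventuallyEq.mvfderiv_eq {f f' : N → E} {x : N} (h : f =ᶠ[𝓝 x] f') :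
    mvfderiv 𝓘(ℝ, F) f x = mvfderiv 𝓘(ℝ, F) f' x := by
  unfold mvfderiv
  rw [h.mfderiv_eq]
  rfl

theorem mvfderiv_comp_mfderiv {M : Type*} [TopologicalSpace M] [ChartedSpace E M]
    {f : M → E'} {i : N → M} {x : N}
    (hf : MDifferentiableAt 𝓘(ℝ, E) 𝓘(ℝ, E') f (i x))
    (hi : MDifferentiableAt 𝓘(ℝ, F) 𝓘(ℝ, E) i x) (w : TangentSpace 𝓘(ℝ, F) x) :
    mvfderiv 𝓘(ℝ, F) (fun z ↦ f (i z)) x w =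
      mvfderiv 𝓘(ℝ, E) f (i x) (mfderiv 𝓘(ℝ, F) 𝓘(ℝ, E) i x w) :=
  mfderiv_comp_apply x hf hi w

end VectorValued

/-! ### Components in a local trivialization of the ambient tangent bundle -/

section Along

set_option linter.unusedSectionVars false

variable {E : Type*} [NormedAddCommGroup E] [NormedSpace ℝ E]
  {M : Type*} [TopologicalSpace M] [ChartedSpace E M] [IsManifold 𝓘(ℝ, E) ∞ M]
  {F : Type*} [NormedAddCommGroup F] [NormedSpace ℝ F]
  {N : Type*} [TopologicalSpace N] [ChartedSpace F N]

/-- The components, in the trivialization of `TM` at `y₀`, of a vector field along `i`. -/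
def alongCoord (i : N → M) (V : ∀ x : N, TangentSpace 𝓘(ℝ, E) (i x)) (y₀ : M) (z : N) : E :=
  (trivializationAt E (TangentSpace 𝓘(ℝ, E) : M → Type _) y₀ ⟨i z, V z⟩).2

/-- The components of a semi-Riemannian metric in the trivialization of `TM` at `y₀`. -/
def SemiRiemannianMetric.coord (g : SemiRiemannianMetric E M) (y₀ y : M) : E →L[ℝ] E →L[ℝ] ℝ :=
  ContinuousLinearMap.inCoordinates E (TangentSpace 𝓘(ℝ, E) : M → Type _) (E →L[ℝ] ℝ)
    (fun y : M ↦ TangentSpace 𝓘(ℝ, E) y →L[ℝ] ℝ) y₀ y y₀ y (g.val y)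

/-- The components of a Golden structure in the trivialization of `TM` at `y₀`. -/
def GoldenStructure.coord {g : SemiRiemannianMetric E M} (P : GoldenStructure g) (y₀ y : M) :
    E →L[ℝ] E :=
  ContinuousLinearMap.inCoordinates E (TangentSpace 𝓘(ℝ, E) : M → Type _) E
    (TangentSpace 𝓘(ℝ, E) : M → Type _) y₀ y y₀ y (P.toFun y)

theorem SemiRiemannianMetric.mdifferentiableAt_coord (g : SemiRiemannianMetric E M) (y₀ : M) :
    MDifferentiableAt 𝓘(ℝ, E) 𝓘(ℝ, E →L[ℝ] E →L[ℝ] ℝ) (g.coord y₀) y₀ :=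
  (((contMDiffAt_hom_bundle _).1 (g.contMDiff y₀)).2).mdifferentiableAt (by simp)

theorem GoldenStructure.mdifferentiableAt_coord {g : SemiRiemannianMetric E M}
    (P : GoldenStructure g) (y₀ : M) :
    MDifferentiableAt 𝓘(ℝ, E) 𝓘(ℝ, E →L[ℝ] E) (P.coord y₀) y₀ :=
  (((contMDiffAt_hom_bundle _).1 (P.contMDiff y₀)).2).mdifferentiableAt (by simp)

theorem SemiRiemannianMetric.coord_apply (g : SemiRiemannianMetric E M) {y₀ y : M}
    (hy : y ∈ (trivializationAt E (TangentSpace 𝓘(ℝ, E) : M → Type _) y₀).baseSet) (a b : E) :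
    g.coord y₀ y a b =
      g.val y ((trivializationAt E (TangentSpace 𝓘(ℝ, E) : M → Type _) y₀).symm y a)
        ((trivializationAt E (TangentSpace 𝓘(ℝ, E) : M → Type _) y₀).symm y b) := by
  have := inCoordinates_apply_eq₂ (F₁ := E) (F₂ := E) (F₃ := ℝ)
    (E₁ := (TangentSpace 𝓘(ℝ, E) : M → Type _)) (E₂ := (TangentSpace 𝓘(ℝ, E) : M → Type _))
    (E₃ := fun _ : M ↦ ℝ) (ϕ := g.val y) (v := a) (w := b) hy hy (by simp)
  simpa [SemiRiemannianMetric.coord] using this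

theorem GoldenStructure.coord_apply {g : SemiRiemannianMetric E M} (P : GoldenStructure g)
    {y₀ y : M}
    (hy : y ∈ (trivializationAt E (TangentSpace 𝓘(ℝ, E) : M → Type _) y₀).baseSet) (a : E) :
    P.coord y₀ y a = (trivializationAt E (TangentSpace 𝓘(ℝ, E) : M → Type _) y₀
      ⟨y, P.toFun y ((trivializationAt E (TangentSpace 𝓘(ℝ, E) : M → Type _) y₀).symm y a)⟩).2 := by
  rw [GoldenStructure.coord, ContinuousLinearMap.inCoordinates_eq hy hy]
  simp [Trivialization.continuousLinearEquivAt_apply]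

theorem symm_alongCoord (i : N → M) (V : ∀ x : N, TangentSpace 𝓘(ℝ, E) (i x)) {y₀ : M} {z : N}
    (hz : i z ∈ (trivializationAt E (TangentSpace 𝓘(ℝ, E) : M → Type _) y₀).baseSet) :
    (trivializationAt E (TangentSpace 𝓘(ℝ, E) : M → Type _) y₀).symm (i z)
      (alongCoord i V y₀ z) = V z :=
  Trivialization.symm_apply_apply_mk _ hz (V z)

theorem eventually_mem_baseSet {i : N → M} {x : N} (hi : ContinuousAt i x) :
    ∀ᶠ z in 𝓝 x, i z ∈ (trivializationAt E (TangentSpace 𝓘(ℝ, E) : M → Type _) (i x)).baseSet :=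
  hi.eventually ((trivializationAt E (TangentSpace 𝓘(ℝ, E) : M → Type _)
    (i x)).open_baseSet.mem_nhds (FiberBundle.mem_baseSet_trivializationAt' (i x)))

theorem mdifferentiableAt_alongCoord {i : N → M} {V : ∀ x : N, TangentSpace 𝓘(ℝ, E) (i x)} {x : N}
    (hV : MDifferentiableAt 𝓘(ℝ, F) 𝓘(ℝ, E).tangent
      (fun z ↦ (⟨i z, V z⟩ : TangentBundle 𝓘(ℝ, E) M)) x) :
    MDifferentiableAt 𝓘(ℝ, F) 𝓘(ℝ, E) (alongCoord i V (i x)) x :=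
  ((mdifferentiableAt_totalSpace _ _).1 hV).2

theorem mdifferentiableAt_of_along {i : N → M} {V : ∀ x : N, TangentSpace 𝓘(ℝ, E) (i x)} {x : N}
    (hV : MDifferentiableAt 𝓘(ℝ, F) 𝓘(ℝ, E).tangent
      (fun z ↦ (⟨i z, V z⟩ : TangentBundle 𝓘(ℝ, E) M)) x) :
    MDifferentiableAt 𝓘(ℝ, F) 𝓘(ℝ, E) i x :=
  ((mdifferentiableAt_totalSpace _ _).1 hV).1

end Along

/-! ### The pulled-back connection is metric and commutes with P -/

section CovAlong

set_option linter.unusedSectionVars false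

variable {E : Type*} [NormedAddCommGroup E] [NormedSpace ℝ E]
  {M : Type*} [TopologicalSpace M] [ChartedSpace E M] [IsManifold 𝓘(ℝ, E) ∞ M]
  {F : Type*} [NormedAddCommGroup F] [NormedSpace ℝ F]
  {N : Type*} [TopologicalSpace N] [ChartedSpace F N] [IsManifold 𝓘(ℝ, F) ∞ N]
  {g : SemiRiemannianMetric E M}
  {cov : CovariantDerivative 𝓘(ℝ, E) E (TangentSpace 𝓘(ℝ, E) : M → Type _)}
  {i : N → M} {x : N}

theorem mdifferentiableAt_tangent_extend {y : M} (a : TangentSpace 𝓘(ℝ, E) y) :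
    MDifferentiableAt 𝓘(ℝ, E) 𝓘(ℝ, E).tangent
      (fun z ↦ (⟨z, FiberBundle.extend E a z⟩ : TangentBundle 𝓘(ℝ, E) M)) y :=
  FiberBundle.mdifferentiableAt_extend 𝓘(ℝ, E) E a

/-- The derivative of the components of the metric, in terms of a metric connection. -/
theorem SemiRiemannianMetric.IsLeviCivita.mvfderiv_coord (hcov : g.IsLeviCivita cov) (y : M)
    (a b w : TangentSpace 𝓘(ℝ, E) y) :
    mvfderiv 𝓘(ℝ, E) (g.coord y) y w
        (trivializationAt E (TangentSpace 𝓘(ℝ, E) : M → Type _) y ⟨y, a⟩).2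
        (trivializationAt E (TangentSpace 𝓘(ℝ, E) : M → Type _) y ⟨y, b⟩).2 =
      g.val y (cov (FiberBundle.extend E a) y w) b +
        g.val y a (cov (FiberBundle.extend E b) y w) := by
  have h := hcov.metric (FiberBundle.extend E a) (FiberBundle.extend E b) y
    (mdifferentiableAt_tangent_extend a) (mdifferentiableAt_tangent_extend b) w
  rw [FiberBundle.extend_apply_self, FiberBundle.extend_apply_self] at h
  rw [← h]
  set a' : E := (trivializationAt E (TangentSpace 𝓘(ℝ, E) : M → Type _) y ⟨y, a⟩).2 with ha'
  set b' : E := (trivializationAt E (TangentSpace 𝓘(ℝ, E) : M → Type _) y ⟨y, b⟩).2 with hb'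
  -- The extended fields have constant components near `y`, so only the components of the metric get
  -- differentiated.
  have he : (fun z ↦ g.val z (FiberBundle.extend E a z) (FiberBundle.extend E b z)) =ᶠ[𝓝 y]
      fun z ↦ g.coord y z a' b' := by
    filter_upwards [eventually_mem_baseSet (E := E) (i := fun z : M ↦ z) (x := y)
      continuousAt_id] with z hz
    rw [g.coord_apply hz]
    rfl
  have hc : ∀ {V : Type _} [NormedAddCommGroup V] [NormedSpace ℝ V] (c : V),
      MDifferentiableAt 𝓘(ℝ, E) 𝓘(ℝ, V) (fun _ : M ↦ c) y := fun c ↦ mdifferentiableAt_const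
  have hG := g.mdifferentiableAt_coord y
  rw [he.mvfderiv_eq, mvfderiv_clm_apply (hG.clm_apply (hc a')) (hc b'),
    mvfderiv_clm_apply hG (hc a'), mvfderiv_const, mvfderiv_const]
  simp

/-- The pulled back connection is a metric connection. -/
theorem SemiRiemannianMetric.IsLeviCivita.mvfderiv_along (hcov : g.IsLeviCivita cov)
    {A B : ∀ x : N, TangentSpace 𝓘(ℝ, E) (i x)}
    (hA : MDifferentiableAt 𝓘(ℝ, F) 𝓘(ℝ, E).tangent
      (fun z ↦ (⟨i z, A z⟩ : TangentBundle 𝓘(ℝ, E) M)) x)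
    (hB : MDifferentiableAt 𝓘(ℝ, F) 𝓘(ℝ, E).tangent
      (fun z ↦ (⟨i z, B z⟩ : TangentBundle 𝓘(ℝ, E) M)) x) (w : TangentSpace 𝓘(ℝ, F) x) :
    mvfderiv 𝓘(ℝ, F) (fun z ↦ g.val (i z) (A z) (B z)) x w =
      g.val (i x) (covAlong cov i A x w) (B x) + g.val (i x) (A x) (covAlong cov i B x w) := by
  have hi := mdifferentiableAt_of_along hA
  have hA' := mdifferentiableAt_alongCoord hA
  have hB' := mdifferentiableAt_alongCoord hB
  have hG := g.mdifferentiableAt_coord (i x)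
  have hGi : MDifferentiableAt 𝓘(ℝ, F) 𝓘(ℝ, E →L[ℝ] E →L[ℝ] ℝ) (fun z ↦ g.coord (i x) (i z)) x :=
    MDifferentiableAt.comp x hG hi
  have hx := FiberBundle.mem_baseSet_trivializationAt' (F := E)
    (E := (TangentSpace 𝓘(ℝ, E) : M → Type _)) (i x)
  have he : (fun z ↦ g.val (i z) (A z) (B z)) =ᶠ[𝓝 x]
      fun z ↦ g.coord (i x) (i z) (alongCoord i A (i x) z) (alongCoord i B (i x) z) := by
    filter_upwards [eventually_mem_baseSet (E := E) hi.continuousAt] with z hz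
    rw [g.coord_apply hz, symm_alongCoord i A hz, symm_alongCoord i B hz]
  rw [he.mvfderiv_eq, mvfderiv_clm_apply (hGi.clm_apply hA') hB', mvfderiv_clm_apply hGi hA',
    mvfderiv_comp_mfderiv hG hi, add_apply, g.coord_apply hx, g.coord_apply hx,
    symm_alongCoord i A hx, symm_alongCoord i B hx]
  -- The derivative of the metric components supplies the two frozen-coefficient terms of
  -- `covAlong`; the derivatives of the components of `A` and `B` supply the other two.
  have h := hcov.mvfderiv_coord (i x) (A x) (B x) (mfderiv 𝓘(ℝ, F) 𝓘(ℝ, E) i x w)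
  unfold alongCoord covAlong at *
  rw [h, map_add, map_add, add_apply]
  ring

theorem mvfderiv_alongCoord_extend (y : M) (a : TangentSpace 𝓘(ℝ, E) y) :
    mvfderiv 𝓘(ℝ, E) (alongCoord (fun z : M ↦ z) (FiberBundle.extend E a) y) y = 0 := by
  have he : alongCoord (fun z : M ↦ z) (FiberBundle.extend E a) y =ᶠ[𝓝 y]
      fun _ ↦ (trivializationAt E (TangentSpace 𝓘(ℝ, E) : M → Type _) y ⟨y, a⟩).2 := by
    filter_upwards [eventually_mem_baseSet (E := E) (i := fun z : M ↦ z) (x := y)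
      continuousAt_id] with z hz
    exact (congrArg Prod.snd (Trivialization.apply_mk_symm _ hz _) :)
  rw [he.mvfderiv_eq, mvfderiv_const]

theorem covAlong_eq (A : ∀ x : N, TangentSpace 𝓘(ℝ, E) (i x)) (w : TangentSpace 𝓘(ℝ, F) x) :
    covAlong cov i A x w =
      (trivializationAt E (TangentSpace 𝓘(ℝ, E) : M → Type _) (i x)).symmL ℝ (i x)
        (mvfderiv 𝓘(ℝ, F) (alongCoord i A (i x)) x w) +
      cov (FiberBundle.extend E (A x)) (i x) (mfderiv 𝓘(ℝ, F) 𝓘(ℝ, E) i x w) := by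
  rw [Trivialization.symmL_apply _ (FiberBundle.mem_baseSet_trivializationAt' (i x))]
  rfl

theorem mfderiv_fun_id_apply (y : M) (w : TangentSpace 𝓘(ℝ, E) y) :
    mfderiv 𝓘(ℝ, E) 𝓘(ℝ, E) (fun z : M ↦ z) y w = w :=
  congrArg (fun T ↦ T w) (mfderiv_id (I := 𝓘(ℝ, E)) (x := y))

theorem covAlong_id_extend (y : M) (a w : TangentSpace 𝓘(ℝ, E) y) :
    covAlong cov (fun z : M ↦ z) (FiberBundle.extend E a) y w =
      cov (FiberBundle.extend E a) y w := by
  rw [covAlong_eq, mvfderiv_alongCoord_extend, FiberBundle.extend_apply_self,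
    mfderiv_fun_id_apply, zero_apply, map_zero, zero_add]

/-- The pull-back of a metric connection by the identity is the connection itself. -/
theorem SemiRiemannianMetric.IsLeviCivita.covAlong_id (hcov : g.IsLeviCivita cov)
    {Y : ∀ y : M, TangentSpace 𝓘(ℝ, E) y} {y : M}
    (hY : MDifferentiableAt 𝓘(ℝ, E) 𝓘(ℝ, E).tangent
      (fun z ↦ (⟨z, Y z⟩ : TangentBundle 𝓘(ℝ, E) M)) y) (w : TangentSpace 𝓘(ℝ, E) y) :
    covAlong cov (fun z : M ↦ z) Y y w = cov Y y w := by
  rw [← sub_eq_zero]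
  -- Both derivatives satisfy the metric identity against the extension of `b`, on which they agree;
  -- nondegeneracy then identifies them.
  refine g.nondegenerate y _ fun b ↦ ?_
  have h1 := hcov.mvfderiv_along (i := fun z : M ↦ z) hY (mdifferentiableAt_tangent_extend b) w
  have h2 := hcov.metric Y (FiberBundle.extend E b) y hY (mdifferentiableAt_tangent_extend b) w
  rw [covAlong_id_extend] at h1
  simp only [FiberBundle.extend_apply_self] at h1 h2
  rw [map_sub, sub_apply]
  linarith

/-- Product rule for the components of `P` and `A`. Only the middle term involves the derivative of
`A`; the other two depend on `A` through its value at `x`, and on `w` through its image under the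
differential of `i`. -/
theorem covAlong_golden (P : GoldenStructure g) {A : ∀ x : N, TangentSpace 𝓘(ℝ, E) (i x)}
    (hA : MDifferentiableAt 𝓘(ℝ, F) 𝓘(ℝ, E).tangent
      (fun z ↦ (⟨i z, A z⟩ : TangentBundle 𝓘(ℝ, E) M)) x) (w : TangentSpace 𝓘(ℝ, F) x) :
    covAlong cov i (fun z ↦ P.toFun (i z) (A z)) x w =
      (trivializationAt E (TangentSpace 𝓘(ℝ, E) : M → Type _) (i x)).symmL ℝ (i x)
        (mvfderiv 𝓘(ℝ, E) (P.coord (i x)) (i x) (mfderiv 𝓘(ℝ, F) 𝓘(ℝ, E) i x w)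
          (alongCoord i A (i x) x)) +
      P.toFun (i x) ((trivializationAt E (TangentSpace 𝓘(ℝ, E) : M → Type _) (i x)).symmL ℝ (i x)
        (mvfderiv 𝓘(ℝ, F) (alongCoord i A (i x)) x w)) +
      cov (FiberBundle.extend E (P.toFun (i x) (A x))) (i x)
        (mfderiv 𝓘(ℝ, F) 𝓘(ℝ, E) i x w) := by
  have hi := mdifferentiableAt_of_along hA
  have hx := FiberBundle.mem_baseSet_trivializationAt' (F := E)
    (E := (TangentSpace 𝓘(ℝ, E) : M → Type _)) (i x)
  have hP := P.mdifferentiableAt_coord (i x)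
  have hPi : MDifferentiableAt 𝓘(ℝ, F) 𝓘(ℝ, E →L[ℝ] E) (fun z ↦ P.coord (i x) (i z)) x :=
    MDifferentiableAt.comp x hP hi
  have he : alongCoord i (fun z ↦ P.toFun (i z) (A z)) (i x) =ᶠ[𝓝 x]
      fun z ↦ P.coord (i x) (i z) (alongCoord i A (i x) z) := by
    filter_upwards [eventually_mem_baseSet (E := E) hi.continuousAt] with z hz
    rw [P.coord_apply hz, symm_alongCoord i A hz]
    rfl
  rw [covAlong_eq, he.mvfderiv_eq, mvfderiv_clm_apply hPi (mdifferentiableAt_alongCoord hA),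
    mvfderiv_comp_mfderiv hP hi, map_add, P.coord_apply hx]
  congr 2
  rw [Trivialization.symmL_apply _ hx, Trivialization.symmL_apply _ hx,
    Trivialization.symm_apply_apply_mk _ hx]

/-- A parallel Golden structure commutes with the pulled back connection. -/
theorem GoldenStructure.IsParallel.covAlong (hcov : g.IsLeviCivita cov) {P : GoldenStructure g}
    (hP : P.IsParallel cov) {A : ∀ x : N, TangentSpace 𝓘(ℝ, E) (i x)}
    (hA : MDifferentiableAt 𝓘(ℝ, F) 𝓘(ℝ, E).tangent
      (fun z ↦ (⟨i z, A z⟩ : TangentBundle 𝓘(ℝ, E) M)) x) (w : TangentSpace 𝓘(ℝ, F) x) :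
    covAlong cov i (fun z ↦ P.toFun (i z) (A z)) x w = P.toFun (i x) (covAlong cov i A x w) := by
  -- Applied to the identity map and a field with constant components, the middle term vanishes, and
  -- parallelism evaluates the sum of the other two. That sum is the one occurring for `A` along
  -- `i`.
  have h := covAlong_golden (cov := cov) P
    (mdifferentiableAt_tangent_extend (A x)) (mfderiv 𝓘(ℝ, F) 𝓘(ℝ, E) i x w)
  rw [hcov.covAlong_id, hP _ _ (mdifferentiableAt_tangent_extend (A x)),
    mvfderiv_alongCoord_extend, mfderiv_fun_id_apply, FiberBundle.extend_apply_self,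
    zero_apply, map_zero, map_zero, add_zero] at h
  · rw [covAlong_golden P hA, covAlong_eq, map_add, h]
    simp only [alongCoord, FiberBundle.extend_apply_self]
    abel
  · exact (P.contMDiff.contMDiffAt.mdifferentiableAt (by simp)).clm_bundle_apply
      (mdifferentiableAt_tangent_extend (A x))

end CovAlong

/-! ### Global extensions of local sections and local left inverses of immersions -/

section Extension

set_option linter.unusedSectionVars false

variable {E : Type*} [NormedAddCommGroup E] [NormedSpace ℝ E]
  {M : Type*} [TopologicalSpace M] [ChartedSpace E M] [IsManifold 𝓘(ℝ, E) ∞ M]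
  {F : Type*} [NormedAddCommGroup F] [NormedSpace ℝ F]
  {N : Type*} [TopologicalSpace N] [ChartedSpace F N] [IsManifold 𝓘(ℝ, F) ∞ N]

/-- A local smooth section of a family of tangent subspaces agrees at a given point with a global
one. -/
theorem exists_smoothVectorField_of_local [FiniteDimensional ℝ F] [T2Space N]
    (D : ∀ z : N, Submodule ℝ (TangentSpace 𝓘(ℝ, F) z)) {x : N}
    {s : ∀ z : N, TangentSpace 𝓘(ℝ, F) z} {O : Set N} (hO : IsOpen O) (hx : x ∈ O)
    (hs : SmoothAlongOn (F := F) (fun z : N ↦ z) s O) (hD : ∀ z ∈ O, s z ∈ D z) :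
    ∃ X : ∀ z : N, TangentSpace 𝓘(ℝ, F) z,
      IsSmoothVectorField X ∧ (∀ z, X z ∈ D z) ∧ X x = s x := by
  obtain ⟨ψ, -, hψ⟩ := (SmoothBumpFunction.nhds_basis_tsupport (I := 𝓘(ℝ, F)) x).mem_iff.1
    (hO.mem_nhds hx)
  refine ⟨fun z ↦ ψ z • s z, ?_, fun z ↦ ?_, ?_⟩
  · exact ContMDiffOn.smul_section_of_tsupport ψ.contMDiff.contMDiffOn hO hψ hs
  · by_cases hz : z ∈ O
    · exact (D z).smul_mem _ (hD z hz)
    · have : ψ z = 0 := image_eq_zero_of_notMem_tsupport fun h ↦ hz (hψ h)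
      simp [this]
  · simp

/-- Every tangent vector is a value of a global smooth vector field. -/
theorem exists_smoothVectorField [FiniteDimensional ℝ F] [T2Space N] {x : N}
    (v : TangentSpace 𝓘(ℝ, F) x) :
    ∃ X : ∀ z : N, TangentSpace 𝓘(ℝ, F) z, IsSmoothVectorField X ∧ X x = v := by
  obtain ⟨S, hS, h⟩ := FiberBundle.exists_contMDiffOn_extend (k := ∞) 𝓘(ℝ, F) F v
  obtain ⟨O, hOS, hO, hx⟩ := mem_nhds_iff.1 hS
  obtain ⟨X, hX, -, hXx⟩ := exists_smoothVectorField_of_local (fun _ ↦ ⊤) hO hx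
    (s := FiberBundle.extend F v) (h.mono hOS) (by simp)
  exact ⟨X, hX, by rw [hXx, FiberBundle.extend_apply_self]⟩

/-- An immersion has smooth local left inverses. -/
theorem exists_leftInverse_of_isImmersion {i : N → M}
    (hi : IsImmersion 𝓘(ℝ, F) 𝓘(ℝ, E) ∞ i) (x : N) :
    ∃ (q : M → N) (S : Set M) (O : Set N), IsOpen S ∧ IsOpen O ∧ x ∈ O ∧ MapsTo i O S ∧
      ContMDiffOn 𝓘(ℝ, E) 𝓘(ℝ, F) ∞ q S ∧ ∀ z ∈ O, q (i z) = z := by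
  have hx := (hi.isImmersionAt x).isImmersionAtOfComplement_complement
  set φ := hx.domChart with hφ
  set ψ := hx.codChart with hψ
  set p : E → F := fun e ↦ (hx.equiv.symm e).1 with hp
  have hp' : ContMDiff 𝓘(ℝ, E) 𝓘(ℝ, F) ∞ p :=
    (contDiff_fst.comp hx.equiv.symm.contDiff).contMDiff
  have hwr : ∀ y ∈ φ.source, p (ψ (i y)) = φ y := by
    intro y hy
    have hmem : φ y ∈ (φ.extend 𝓘(ℝ, F)).target := by simpa using φ.map_source hy
    have := hx.writtenInCharts hmem
    have : ψ (i y) = hx.equiv (φ y, 0) := by simpa [← hφ, ← hψ, φ.left_inv hy] using this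
    simp [hp, this]
  -- In adapted charts the immersion is u ↦ (u, 0), so projecting to the first factor undoes it. The
  -- domain is cut down so that the projection lands in the target of `φ`.
  refine ⟨φ.symm ∘ p ∘ ψ, ψ.source ∩ ψ ⁻¹' (p ⁻¹' φ.target), φ.source,
    ψ.isOpen_inter_preimage (φ.open_target.preimage hp'.continuous), φ.open_source,
    hx.mem_domChart_source, fun z hz ↦ ⟨hx.source_subset_preimage_source hz, ?_⟩, ?_, ?_⟩
  · simpa [hwr z hz] using φ.map_source hz
  · exact (contMDiffOn_symm_of_mem_maximalAtlas hx.domChart_mem_maximalAtlas).comp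
      (hp'.comp_contMDiffOn ((contMDiffOn_of_mem_maximalAtlas
        hx.codChart_mem_maximalAtlas).mono inter_subset_left)) fun y hy ↦ hy.2
  · intro z hz
    simp [hwr z hz, φ.left_inv hz]

/-- The image of a smooth field along `i` under the differential of a smooth local left inverse of
`i` is a smooth vector field. -/
theorem SmoothAlongOn.mfderiv_leftInverse {i : N → M} {q : M → N} {S : Set M} {O : Set N}
    (hS : IsOpen S) (hiO : MapsTo i O S) (hq : ContMDiffOn 𝓘(ℝ, E) 𝓘(ℝ, F) ∞ q S)
    (hqi : ∀ z ∈ O, q (i z) = z) {V : ∀ z : N, TangentSpace 𝓘(ℝ, E) (i z)}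
    (hV : SmoothAlongOn (F := F) i V O) :
    SmoothAlongOn (F := F) (fun z : N ↦ z)
      (fun z ↦ (mfderiv 𝓘(ℝ, E) 𝓘(ℝ, F) q (i z) (V z) : F)) O := by
  have h := (hq.contMDiffOn_tangentMapWithin (m := ∞) (by simp) hS.uniqueMDiffOn).comp hV
    fun z hz ↦ hiO hz
  refine h.congr fun z hz ↦ ?_
  change (⟨z, _⟩ : TangentBundle 𝓘(ℝ, F) N) =
    ⟨q (i z), mfderivWithin 𝓘(ℝ, E) 𝓘(ℝ, F) q S (i z) (V z)⟩
  rw [mfderivWithin_of_isOpen hS (hiO hz)]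
  exact congrArg (fun y : N ↦ (⟨y, (mfderiv 𝓘(ℝ, E) 𝓘(ℝ, F) q (i z) (V z) : F)⟩ :
    TangentBundle 𝓘(ℝ, F) N)) (hqi z hz).symm

end Extension

/-! ### Screen and radical components, and smooth sections of the radical -/

section Lightlike

set_option linter.unusedSectionVars false

variable {E : Type*} [NormedAddCommGroup E] [NormedSpace ℝ E]
  {M : Type*} [TopologicalSpace M] [ChartedSpace E M] [IsManifold 𝓘(ℝ, E) ∞ M]
  {F : Type*} [NormedAddCommGroup F] [NormedSpace ℝ F]
  {N : Type*} [TopologicalSpace N] [ChartedSpace F N] [IsManifold 𝓘(ℝ, F) ∞ N]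
  {g : SemiRiemannianMetric E M} {i : N → M}

theorem IsSmoothVectorField.contMDiff_mfderiv {U : ∀ x : N, TangentSpace 𝓘(ℝ, F) x}
    (hU : IsSmoothVectorField U) (hi : ContMDiff 𝓘(ℝ, F) 𝓘(ℝ, E) ∞ i) :
    ContMDiff 𝓘(ℝ, F) 𝓘(ℝ, E).tangent ∞
      (fun z ↦ (⟨i z, mfderiv 𝓘(ℝ, F) 𝓘(ℝ, E) i z (U z)⟩ : TangentBundle 𝓘(ℝ, E) M)) :=
  (hi.contMDiff_tangentMap (m := ∞) (by simp)).comp hU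

theorem SmoothAlongOn.golden (P : GoldenStructure g) {O : Set N}
    {V : ∀ x : N, TangentSpace 𝓘(ℝ, E) (i x)} (hi : ContMDiff 𝓘(ℝ, F) 𝓘(ℝ, E) ∞ i)
    (hV : SmoothAlongOn (F := F) i V O) :
    SmoothAlongOn (F := F) i (fun z ↦ P.toFun (i z) (V z)) O :=
  ContMDiffOn.clm_bundle_apply (P.contMDiff.comp_contMDiffOn hi.contMDiffOn) hV

namespace LightlikeSubmanifold

variable (L : LightlikeSubmanifold (F := F) g i)

theorem exists_eq_tangentPart_add (x : N) (a : TangentSpace 𝓘(ℝ, E) (i x)) :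
    ∃ t ∈ L.ltr x ⊔ L.screenTrans x,
      a = mfderiv 𝓘(ℝ, F) 𝓘(ℝ, E) i x (L.tangentPart x a) + t := by
  refine ⟨_, Submodule.projection_apply_mem (L.isCompl_tr x).symm a, ?_⟩
  have h := Submodule.projection_add_projection_eq_self (L.isCompl_tr x) a
  have h' : mfderiv 𝓘(ℝ, F) 𝓘(ℝ, E) i x (L.tangentPart x a) =
      Submodule.projectionOnto (tangentImage (F := F) i x) _ (L.isCompl_tr x) a := by
    have := LinearEquiv.apply_symm_apply (LinearEquiv.ofInjective
      (mfderiv 𝓘(ℝ, F) 𝓘(ℝ, E) i x).toLinearMap (immersion_mfderiv_injective L.immersion x))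
      (Submodule.projectionOnto (tangentImage (F := F) i x) _ (L.isCompl_tr x) a)
    exact congrArg Subtype.val this
  rw [h']
  exact h.symm

/-- The `ltr` summand is orthogonal to the screen by assumption; the screen transversal summand lies
in the normal space. -/
theorem tr_orthogonal_screen {x : N} {t : TangentSpace 𝓘(ℝ, E) (i x)}
    (ht : t ∈ L.ltr x ⊔ L.screenTrans x) {u : TangentSpace 𝓘(ℝ, F) x} (hu : u ∈ L.screen x) :
    g.val (i x) t (mfderiv 𝓘(ℝ, F) 𝓘(ℝ, E) i x u) = 0 := by
  obtain ⟨n, hn, z, hz, rfl⟩ := Submodule.mem_sup.1 ht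
  have hz' : z ∈ normalSpace (F := F) g i x := L.screenTrans_sup x ▸ Submodule.mem_sup_right hz
  rw [map_add, add_apply, L.ltr_orthogonal_screen x n hn u hu, hz' u, add_zero]

theorem val_tangentPart_screen {x : N} (a : TangentSpace 𝓘(ℝ, E) (i x))
    {u : TangentSpace 𝓘(ℝ, F) x} (hu : u ∈ L.screen x) :
    inducedMetric g i x (L.tangentPart x a) u =
      g.val (i x) a (mfderiv 𝓘(ℝ, F) 𝓘(ℝ, E) i x u) := by
  obtain ⟨t, ht, h⟩ := L.exists_eq_tangentPart_add x a
  conv_rhs => rw [h, map_add, add_apply, L.tr_orthogonal_screen ht hu, add_zero]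
  rfl

theorem exists_radical_add_screen (x : N) (u : TangentSpace 𝓘(ℝ, F) x) :
    ∃ ρ ∈ radical (F := F) g i x, ∃ s ∈ L.screen x, u = ρ + s := by
  have hu : u ∈ radical (F := F) g i x ⊔ L.screen x := by
    rw [(L.isCompl_screen x).sup_eq_top]; trivial
  obtain ⟨ρ, hρ, s, hs, h⟩ := Submodule.mem_sup.1 hu
  exact ⟨ρ, hρ, s, hs, h.symm⟩

theorem inducedMetric_radical_left {x : N} {ρ : TangentSpace 𝓘(ℝ, F) x}
    (hρ : ρ ∈ radical (F := F) g i x) (u : TangentSpace 𝓘(ℝ, F) x) :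
    inducedMetric g i x ρ u = 0 := hρ u

theorem inducedMetric_symm (x : N) (u v : TangentSpace 𝓘(ℝ, F) x) :
    inducedMetric g i x u v = inducedMetric g i x v u := g.symm _ _ _

theorem inducedMetric_add_right (x : N) (u v w : TangentSpace 𝓘(ℝ, F) x) :
    inducedMetric g i x u (v + w) = inducedMetric g i x u v + inducedMetric g i x u w := by
  simp [inducedMetric]

/-- The tangent space is Rad ⊕ screen, and the radical pairs to zero with everything tangent. -/
theorem mem_radical_iff_screen {x : N} {v : TangentSpace 𝓘(ℝ, F) x} :
    v ∈ radical (F := F) g i x ↔ ∀ u ∈ L.screen x, inducedMetric g i x v u = 0 := by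
  refine ⟨fun h u _ ↦ h u, fun h u ↦ ?_⟩
  obtain ⟨ρ, hρ, s, hs, rfl⟩ := L.exists_radical_add_screen x u
  change inducedMetric g i x v (ρ + s) = 0
  rw [inducedMetric_add_right, inducedMetric_symm, inducedMetric_radical_left hρ, h s hs, add_zero]

/-- Projecting to the tangent space preserves pairings with the screen but kills those with the
radical; the subtracted term is the loss, and is the source of any failure of metricity. -/
theorem inducedMetric_tangentPart {x : N} (a : TangentSpace 𝓘(ℝ, E) (i x))
    {ρ s : TangentSpace 𝓘(ℝ, F) x} (hρ : ρ ∈ radical (F := F) g i x) (hs : s ∈ L.screen x) :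
    inducedMetric g i x (L.tangentPart x a) (ρ + s) =
      g.val (i x) a (mfderiv 𝓘(ℝ, F) 𝓘(ℝ, E) i x (ρ + s)) -
        g.val (i x) a (mfderiv 𝓘(ℝ, F) 𝓘(ℝ, E) i x ρ) := by
  rw [inducedMetric_add_right, inducedMetric_symm, inducedMetric_radical_left hρ,
    L.val_tangentPart_screen a hs, map_add, map_add]
  ring

/-- Every vector of the radical of a radical transversal lightlike submanifold is a value of a
global smooth section of the radical distribution. -/
theorem IsRadicalTransversal.exists_smooth_radical [FiniteDimensional ℝ F] [T2Space N]
    {L : LightlikeSubmanifold (F := F) g i} {P : GoldenStructure g}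
    (hL : L.IsRadicalTransversal P) {x : N} {v : TangentSpace 𝓘(ℝ, F) x}
    (hv : v ∈ radical (F := F) g i x) :
    ∃ ξ : ∀ z : N, TangentSpace 𝓘(ℝ, F) z,
      IsSmoothVectorField ξ ∧ (∀ z, ξ z ∈ radical (F := F) g i z) ∧ ξ x = v := by
  have hi : ContMDiff 𝓘(ℝ, F) 𝓘(ℝ, E) ∞ i := L.immersion.contMDiff
  obtain ⟨q, S, O₁, hS, hO₁, hx₁, hiO, hq, hqi⟩ := exists_leftInverse_of_isImmersion L.immersion x
  obtain ⟨k, n, O₂, hO₂, hx₂, hn, hspan⟩ := L.ltr_smooth x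
  set O := O₁ ∩ O₂
  have hdq : ∀ z ∈ O₁, ∀ u : TangentSpace 𝓘(ℝ, F) z,
      (mfderiv 𝓘(ℝ, E) 𝓘(ℝ, F) q (i z) (mfderiv 𝓘(ℝ, F) 𝓘(ℝ, E) i z u) : F) = u := by
    intro z hz u
    have h1 : MDifferentiableAt 𝓘(ℝ, E) 𝓘(ℝ, F) q (i z) :=
      (hq.contMDiffAt (hS.mem_nhds (hiO hz))).mdifferentiableAt (by simp)
    have h2 : MDifferentiableAt 𝓘(ℝ, F) 𝓘(ℝ, E) i z := hi.contMDiffAt.mdifferentiableAt (by simp)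
    have h3 : q ∘ i =ᶠ[𝓝 z] id := by
      filter_upwards [hO₁.mem_nhds hz] with y hy using hqi y hy
    have h4 := mfderiv_comp z h1 h2
    rw [h3.mfderiv_eq, mfderiv_id] at h4
    exact (congrArg (fun T ↦ T u) h4).symm
  -- Smoothness is given for `ltr`, not for the radical, so the frame is transported. By P² = P + I
  -- the inverse of P is P - I, and `dq` inverts the differential of `i` on its image: ρ_a is the
  -- radical vector that P sends to n_a.
  let ρ : Fin k → ∀ z : N, TangentSpace 𝓘(ℝ, F) z := fun a z ↦
    ((mfderiv 𝓘(ℝ, E) 𝓘(ℝ, F) q (i z) (P.toFun (i z) (n a z)) : F) -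
      (mfderiv 𝓘(ℝ, E) 𝓘(ℝ, F) q (i z) (n a z) : F) : F)
  have hρs : ∀ a, SmoothAlongOn (F := F) (fun z : N ↦ z) (ρ a) O := by
    intro a
    have h1 : SmoothAlongOn (F := F) i (n a) O := (hn a).mono inter_subset_right
    have hiO' : MapsTo i O S := hiO.mono_left inter_subset_left
    have hqi' : ∀ z ∈ O, q (i z) = z := fun z hz ↦ hqi z hz.1
    exact ContMDiffOn.sub_section ((h1.golden P hi).mfderiv_leftInverse hS hiO' hq hqi')
      (h1.mfderiv_leftInverse hS hiO' hq hqi')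
  have key : ∀ z ∈ O₁, ∀ u ∈ radical (F := F) g i z, ∀ m : TangentSpace 𝓘(ℝ, E) (i z),
      m = P.toFun (i z) (mfderiv 𝓘(ℝ, F) 𝓘(ℝ, E) i z u) →
      ((mfderiv 𝓘(ℝ, E) 𝓘(ℝ, F) q (i z) (P.toFun (i z) m) : F) -
        (mfderiv 𝓘(ℝ, E) 𝓘(ℝ, F) q (i z) m : F) : F) = u := by
    rintro z hz u hu m rfl
    rw [P.golden]
    exact ((congrArg (fun v : F ↦ v - _) (map_add _ _ _)).trans (add_sub_cancel_left _ _)).trans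
      (hdq z hz u)
  have hρ : ∀ a, ∀ z ∈ O, ρ a z ∈ radical (F := F) g i z := by
    intro a z hz
    have h1 : n a z ∈ L.ltr z := by
      rw [← (hspan z hz.2).2]
      exact Submodule.subset_span ⟨a, rfl⟩
    rw [← hL.map_radical z] at h1
    obtain ⟨_, ⟨u, hu, rfl⟩, h2⟩ := h1
    have h3 : ρ a z = u := key z hz.1 u hu _ h2.symm
    rw [h3]
    exact hu
  have hPv : P.toFun (i x) (mfderiv 𝓘(ℝ, F) 𝓘(ℝ, E) i x v) ∈
      Submodule.span ℝ (range fun a ↦ n a x) := by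
    rw [(hspan x hx₂).2, ← hL.map_radical x]
    exact ⟨_, ⟨v, hv, rfl⟩, rfl⟩
  obtain ⟨c, hc⟩ := (Submodule.mem_span_range_iff_exists_fun ℝ).1 hPv
  have hsum : (∑ a, c a • ρ a x) = v := by
    refine Eq.trans ?_ (key x hx₁ v hv _ hc)
    let T : TangentSpace 𝓘(ℝ, E) (i x) →L[ℝ] TangentSpace 𝓘(ℝ, F) (q (i x)) :=
      (mfderiv 𝓘(ℝ, E) 𝓘(ℝ, F) q (i x)).comp (P.toFun (i x)) - mfderiv 𝓘(ℝ, E) 𝓘(ℝ, F) q (i x)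
    have hT : T (∑ a, c a • n a x) = ∑ a, c a • T (n a x) := by simp only [map_sum, map_smul]
    exact hT.symm
  obtain ⟨X, hX, hXr, hXx⟩ := exists_smoothVectorField_of_local (fun z ↦ radical (F := F) g i z)
    (s := fun z ↦ ∑ a, c a • ρ a z) (hO₁.inter hO₂) ⟨hx₁, hx₂⟩
    (ContMDiffOn.sum_section fun a _ ↦ ContMDiffOn.const_smul_section (hρs a))
    fun z hz ↦ Submodule.sum_mem _ fun a _ ↦ Submodule.smul_mem _ _ (hρ a z hz)
  exact ⟨X, hX, hXr, hXx.trans hsum⟩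

/-! ### The intermediate condition and its two equivalences -/

variable {cov : CovariantDerivative 𝓘(ℝ, E) E (TangentSpace 𝓘(ℝ, E) : M → Type _)}

/-- The derivative of the induced metric in terms of the ambient connection. -/
theorem mvfderiv_inducedMetric (hcov : g.IsLeviCivita cov) (hi : ContMDiff 𝓘(ℝ, F) 𝓘(ℝ, E) ∞ i)
    {U V : ∀ x : N, TangentSpace 𝓘(ℝ, F) x} (hU : IsSmoothVectorField U)
    (hV : IsSmoothVectorField V) (x : N) (w : TangentSpace 𝓘(ℝ, F) x) :
    mvfderiv 𝓘(ℝ, F) (fun z ↦ inducedMetric g i z (U z) (V z)) x w =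
      g.val (i x) (covAlong cov i (fun z ↦ mfderiv 𝓘(ℝ, F) 𝓘(ℝ, E) i z (U z)) x w)
          (mfderiv 𝓘(ℝ, F) 𝓘(ℝ, E) i x (V x)) +
        g.val (i x) (covAlong cov i (fun z ↦ mfderiv 𝓘(ℝ, F) 𝓘(ℝ, E) i z (V z)) x w)
          (mfderiv 𝓘(ℝ, F) 𝓘(ℝ, E) i x (U x)) := by
  have h := hcov.mvfderiv_along
    ((hU.contMDiff_mfderiv hi).contMDiffAt.mdifferentiableAt (x := x) (by simp))
    ((hV.contMDiff_mfderiv hi).contMDiffAt.mdifferentiableAt (by simp)) w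
  rw [g.symm _ _ (covAlong _ _ _ _ _)] at h
  exact h

theorem mvfderiv_inducedMetric_radical {U ξ : ∀ x : N, TangentSpace 𝓘(ℝ, F) x}
    (hξ : ∀ x, ξ x ∈ radical (F := F) g i x) (x : N) (w : TangentSpace 𝓘(ℝ, F) x) :
    mvfderiv 𝓘(ℝ, F) (fun z ↦ inducedMetric g i z (ξ z) (U z)) x w = 0 := by
  have : (fun z ↦ inducedMetric g i z (ξ z) (U z)) = fun _ ↦ 0 :=
    funext fun z ↦ inducedMetric_radical_left (hξ z) _
  rw [this, mvfderiv_const, zero_apply]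

/-- The ambient covariant derivatives of the sections of the radical distribution, in tangent
directions, are orthogonal to the screen distribution. -/
def RadicalDerivOrthogonalScreen (L : LightlikeSubmanifold (F := F) g i)
    (cov : CovariantDerivative 𝓘(ℝ, E) E (TangentSpace 𝓘(ℝ, E) : M → Type _)) : Prop :=
  ∀ W ξ : (∀ x : N, TangentSpace 𝓘(ℝ, F) x), IsSmoothVectorField W → IsSmoothVectorField ξ →
    (∀ x, ξ x ∈ radical g i x) → ∀ x : N, ∀ u ∈ L.screen x,
      g.val (i x) (covAlong cov i (fun z ↦ mfderiv 𝓘(ℝ, F) 𝓘(ℝ, E) i z (ξ z)) x (W x))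
        (mfderiv 𝓘(ℝ, F) 𝓘(ℝ, E) i x u) = 0

/-- Metricity is tested on ξ and an extension of `u`: g(ξ, U) vanishes identically, as does the term
with ξ undifferentiated. -/
theorem InducedConnectionIsMetric.radicalDerivOrthogonalScreen [FiniteDimensional ℝ F] [T2Space N]
    {L : LightlikeSubmanifold (F := F) g i} (h : L.InducedConnectionIsMetric cov) :
    L.RadicalDerivOrthogonalScreen cov := by
  intro W ξ hW hξ hξr x u hu
  obtain ⟨U, hU, hUx⟩ := exists_smoothVectorField u
  have h1 := h W ξ U hW hξ hU x
  rw [mvfderiv_inducedMetric_radical hξr, inducedMetric_radical_left (hξr x), hUx, add_zero] at h1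
  rw [← L.val_tangentPart_screen _ hu]
  exact h1.symm

theorem RadicalDerivOrthogonalScreen.inducedConnectionIsMetric [FiniteDimensional ℝ F] [T2Space N]
    (hcov : g.IsLeviCivita cov) {L : LightlikeSubmanifold (F := F) g i} {P : GoldenStructure g}
    (hL : L.IsRadicalTransversal P) (h : L.RadicalDerivOrthogonalScreen cov) :
    L.InducedConnectionIsMetric cov := by
  intro W U V hW hU hV x
  have hi : ContMDiff 𝓘(ℝ, F) 𝓘(ℝ, E) ∞ i := L.immersion.contMDiff
  obtain ⟨ρ, hρ, s, hs, hUx⟩ := L.exists_radical_add_screen x (U x)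
  obtain ⟨σ, hσ, t, ht, hVx⟩ := L.exists_radical_add_screen x (V x)
  obtain ⟨η, hη, hηr, hηx⟩ := hL.exists_smooth_radical hρ
  obtain ⟨ξ, hξ, hξr, hξx⟩ := hL.exists_smooth_radical hσ
  have h1 := mvfderiv_inducedMetric hcov hi hξ hU x (W x)
  have h2 := mvfderiv_inducedMetric hcov hi hη hV x (W x)
  have h3 := mvfderiv_inducedMetric hcov hi hη hξ x (W x)
  have h4 := h W ξ hW hξ hξr x s hs
  have h5 := h W η hW hη hηr x t ht
  rw [mvfderiv_inducedMetric_radical hξr, hUx, hξx, map_add, map_add, h4] at h1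
  rw [mvfderiv_inducedMetric_radical hηr, hVx, hηx, map_add, map_add, h5] at h2
  -- The relations `h1` and `h2` replace derivatives of `U` and `V` by those of ξ and η; `h3` makes
  -- the latter two pairings cancel.
  rw [mvfderiv_inducedMetric_radical hηr, hηx, hξx] at h3
  rw [mvfderiv_inducedMetric hcov hi hU hV x (W x), inducedMetric_symm x (U x)]
  unfold inducedConnection
  rw [hUx, hVx, L.inducedMetric_tangentPart _ hρ hs, L.inducedMetric_tangentPart _ hσ ht]
  linarith

/-- P passes through D and, being self-adjoint, onto the screen vector. That P maps the screen into
itself gives one direction, that it maps onto it the other. -/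
theorem radicalDerivOrthogonalScreen_iff (hcov : g.IsLeviCivita cov)
    {L : LightlikeSubmanifold (F := F) g i} {P : GoldenStructure g} (hP : P.IsParallel cov)
    (hL : L.IsRadicalTransversal P) :
    L.RadicalDerivOrthogonalScreen cov ↔
      ∀ W ξ : (∀ x : N, TangentSpace 𝓘(ℝ, F) x),
        IsSmoothVectorField W → IsSmoothVectorField ξ → (∀ x, ξ x ∈ radical g i x) →
        ∀ x : N,
          L.shapeOperator cov (fun z ↦ P.toFun (i z) (mfderiv 𝓘(ℝ, F) 𝓘(ℝ, E) i z (ξ z)))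
            x (W x) ∈ radical g i x := by
  refine forall₅_congr fun W ξ _ hξ _ ↦ forall_congr' fun x ↦ ?_
  rw [shapeOperator, neg_mem_iff, L.mem_radical_iff_screen, hP.covAlong hcov
    ((hξ.contMDiff_mfderiv L.immersion.contMDiff).contMDiffAt.mdifferentiableAt (by simp))]
  have hPS : ∀ u ∈ L.screen x, ∃ v ∈ L.screen x,
      P.toFun (i x) (mfderiv 𝓘(ℝ, F) 𝓘(ℝ, E) i x u) = mfderiv 𝓘(ℝ, F) 𝓘(ℝ, E) i x v := by
    intro u hu
    have := (hL.map_screen x).le ⟨_, ⟨u, hu, rfl⟩, rfl⟩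
    obtain ⟨v, hv, h⟩ := this
    exact ⟨v, hv, h.symm⟩
  have hSP : ∀ v ∈ L.screen x, ∃ u ∈ L.screen x,
      P.toFun (i x) (mfderiv 𝓘(ℝ, F) 𝓘(ℝ, E) i x u) = mfderiv 𝓘(ℝ, F) 𝓘(ℝ, E) i x v := by
    intro v hv
    obtain ⟨_, ⟨u, hu, rfl⟩, h⟩ := (hL.map_screen x).ge ⟨v, hv, rfl⟩
    exact ⟨u, hu, h⟩
  constructor
  · intro h u hu
    obtain ⟨v, hv, huv⟩ := hPS u hu
    rw [L.val_tangentPart_screen _ hu, P.compatible, huv, h v hv]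
  · intro h v hv
    obtain ⟨u, hu, huv⟩ := hSP v hv
    rw [← huv, ← P.compatible, ← L.val_tangentPart_screen _ hu, h u hu]

end LightlikeSubmanifold

end Lightlike

end

theorem mainTheorem1
    {E : Type*} [NormedAddCommGroup E] [NormedSpace ℝ E] [FiniteDimensional ℝ E]
    {M : Type*} [TopologicalSpace M] [T2Space M] [ChartedSpace E M] [IsManifold 𝓘(ℝ, E) ∞ M]
    {F : Type*} [NormedAddCommGroup F] [NormedSpace ℝ F] [FiniteDimensional ℝ F]
    {N : Type*} [TopologicalSpace N] [T2Space N] [ChartedSpace F N] [IsManifold 𝓘(ℝ, F) ∞ N]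
    (g : SemiRiemannianMetric E M) (P : GoldenStructure g)
    (cov : CovariantDerivative 𝓘(ℝ, E) E (TangentSpace 𝓘(ℝ, E) : M → Type _))
    (hcov : g.IsLeviCivita cov) (hP : P.IsParallel cov)
    (i : N → M) (L : LightlikeSubmanifold (F := F) g i) (hL : L.IsRadicalTransversal P) :
    L.InducedConnectionIsMetric cov ↔
      ∀ W ξ : (∀ x : N, TangentSpace 𝓘(ℝ, F) x),
        IsSmoothVectorField W → IsSmoothVectorField ξ → (∀ x, ξ x ∈ radical g i x) →
        ∀ x : N,
          L.shapeOperator cov (fun z ↦ P.toFun (i z) (mfderiv 𝓘(ℝ, F) 𝓘(ℝ, E) i z (ξ z)))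
            x (W x) ∈ radical g i x := by
  rw [← LightlikeSubmanifold.radicalDerivOrthogonalScreen_iff hcov hP hL]
  exact ⟨fun h ↦ h.radicalDerivOrthogonalScreen, fun h ↦ h.inducedConnectionIsMetric hcov hL⟩
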